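/- \textbf{Setting.} Let $P$ be a set of propositional letters. The formulas of BFNL* are built from letters, $\bot$, $\top$ by $\wedge,\vee,\cdot,\backslash,/$ and Boolean negation $\neg$; the formulas of BDFNL* are those without $\neg$. Antecedents are binary trees of formulas $\Gamma ::= A\mid \Gamma\circ\Delta$, or the empty antecedent $\Lambda$, which is neutral: $\Lambda\circ\Gamma=\Gamma=\Gamma\circ\Lambda$. A sequent is $\Gamma\Rightarrow A$ with $A$ a formula; $\Gamma[-]$ denotes a tree with one hole, and $\Gamma,\Delta$ may be empty in all axioms and rules below. BDFNL* has the axioms $A\Rightarrow A$; $A\wedge(B\vee C)\Rightarrow (A\wedge B)\vee(A\wedge C)$; $\Gamma[\bot]\Rightarrow A$; $\Gamma\Rightarrow\top$; and the rules (\(\backslash\)L) from $\Delta\Rightarrow A$ and $\Gamma[B]\Rightarrow C$ infer $\Gamma[\Delta\circ(A\backslash B)]\Rightarrow C$; (\(\backslash\)R) from $A\circ\Gamma\Rightarrow B$ infer $\Gamma\Rightarrow A\backslash B$; (/L) from $\Gamma[A]\Rightarrow C$ and $\Delta\Rightarrow B$ infer $\Gamma[(A/B)\circ\Delta]\Rightarrow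 C$; (/R) from $\Gamma\circ B\Rightarrow A$ infer $\Gamma\Rightarrow A/B$; ($\cdot$L) from $\Gamma[A\circ B]\Rightarrow C$ infer $\Gamma[A\cdot B]\Rightarrow C$; ($\cdot$R) from $\Gamma\Rightarrow A$ and $\Delta\Rightarrow B$ infer $\Gamma\circ\Delta\Rightarrow A\cdot B$; (Cut) from $\Delta\Rightarrow A$ and $\Gamma[A]\Rightarrow B$ infer $\Gamma[\Delta]\Rightarrow B$; ($\wedge$L) from $\Gamma[A_i]\Rightarrow B$ infer $\Gamma[A_1\wedge A_2]\Rightarrow B$ ($i=1,2$); ($\wedge$R) from $\Gamma\Rightarrow A$ and $\Gamma\Rightarrow B$ infer $\Gamma\Rightarrow A\wedge B$; ($\vee$L) from $\Gamma[A_1]\Rightarrow B$ and $\Gamma[A_2]\Rightarrow B$ infer $\Gamma[A_1\vee A_2]\Rightarrow B$; ($\vee$R) from $\Gamma\Rightarrow A_i$ infer $\Gamma\Rightarrow A_1\vee A_2$ ($i=1,2$). BFNL* has the same axioms and rules for the language with $\neg$, and in addition the axioms $A\wedge\neg A\Rightarrow\bot$ and $\top\Rightarrow A\vee\neg A$. For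 a set $\Phi$ of sequents, $\Phi\vdash_S \Gamma\Rightarrow A$ means that $\Gamma\Rightarrow A$ has a derivation in $S$ from the sequents in $\Phi$ as additional axioms (not closed under substitution). Extend $P$ by a fresh letter $p_A$ for every BDFNL*-formula $A$ over the extended set of letters (distinct letters for distinct formulas). Put $\top^\sim=\bot$, $\bot^\sim=\top$, and $A^\sim=p_A$ for every other $A$. Define the map $\ddagger$ from BFNL*-formulas over $P$ to BDFNL*-formulas over the extended letters by $p^\ddagger=p$, $\bot^\ddagger=\bot$, $\top^\ddagger=\top$, $(A\star B)^\ddagger=A^\ddagger\star B^\ddagger$ for $\star\in\{\cdot,\backslash,/,\wedge,\vee\}$, and $(\neg A)^\ddagger=(A^\ddagger)^\sim$; $\Gamma^\ddagger$ is obtained by applying $\ddagger$ to every formula of $\Gamma$. \textbf{Theorem.} Let $\Gamma\Rightarrow A$ be a BFNL*-sequent over $P$, let $T$ be the set of all subformulas of formulas occurring in $\Gamma\Rightarrow A$ together with $\top$ and $\bot$, let $exn(T)=\{B^\ddagger\mid B\in T\}$, and let $$\Psi[exn(T)]=\{B\wedge p_B\Rightarrow\bot\mid B\in exn(T)\}\cup\{\top\Rightarrow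 B\vee p_B\mid B\in exn(T)\}.$$ Then $\Psi[exn(T)]$ is finite, and $$\vdash_{\mathrm{BFNL^*}}\Gamma\Rightarrow A\quad\text{iff}\quad \Psi[exn(T)]\vdash_{\mathrm{BDFNL^*}}\Gamma^\ddagger\Rightarrow A^\ddagger .$$ -/

import Mathlib

universe u

namespace Lambek

/-- Formulas of BFNL* over the set `α` of propositional letters.
`under A B` is `A \ B`, `over A B` is `A / B`, and `prod A B` is `A · B`. -/
inductive BFormula (α : Type u) : Type u
  | letter (p : α)
  | bot
  | top
  | and (A B : BFormula α)
  | or (A B : BFormula α)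
  | under (A B : BFormula α)
  | over (A B : BFormula α)
  | prod (A B : BFormula α)
  | neg (A : BFormula α)

/-- Formulas of BDFNL* (no Boolean negation) over the set `α` of propositional letters.
`under A B` is `A \ B`, `over A B` is `A / B`, and `prod A B` is `A · B`. -/
inductive BDFormula (α : Type u) : Type u
  | letter (p : α)
  | bot
  | top
  | and (A B : BDFormula α)
  | or (A B : BDFormula α)
  | under (A B : BDFormula α)
  | over (A B : BDFormula α)
  | prod (A B : BDFormula α)

/-- Antecedents of sequents over a type `F` of formulas: binary formula trees, and the empty
antecedent `Λ`. -/
inductive Tree (F : Type u) : Type u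
  | empty
  | leaf (A : F)
  | node (Γ Δ : Tree F)

/-- Applies a map of formulas at every leaf. -/
def Tree.map {F G : Type u} (f : F → G) : Tree F → Tree G
  | .empty => .empty
  | .leaf A => .leaf (f A)
  | .node Γ Δ => .node (Γ.map f) (Δ.map f)

/-- The set of formulas occurring (as leaves) in an antecedent. -/
def Tree.formulas {F : Type u} : Tree F → Set F
  | .empty => ∅
  | .leaf A => {A}
  | .node Γ Δ => Γ.formulas ∪ Δ.formulas

/-- Trees `Γ[-]` with one hole. -/
inductive Context (F : Type u) : Type u
  | hole
  | nodeL (Γ : Context F) (Δ : Tree F)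
  | nodeR (Δ : Tree F) (Γ : Context F)

/-- `Γ.plug Δ` is `Γ[Δ]`. -/
def Context.plug {F : Type u} : Context F → Tree F → Tree F
  | .hole, Θ => Θ
  | .nodeL Γ Δ, Θ => .node (Γ.plug Θ) Δ
  | .nodeR Δ Γ, Θ => .node Δ (Γ.plug Θ)

/-- A sequent `Γ ⇒ A`. -/
structure Sequent (F : Type u) : Type u where
  ant : Tree F
  suc : F

/-- `BFNL.Derivable Φ Γ A`: the sequent `Γ ⇒ A` is derivable from the assumptions `Φ` in the
sequent calculus BFNL*. The assumptions are
not closed under substitution. The last four rules express that the empty antecedent `Λ` is neutral,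
`Λ ∘ Δ = Δ = Δ ∘ Λ`; in all rules the metavariables for antecedents may be empty. -/
inductive BFNL.Derivable {α : Type u} (Φ : Set (Sequent (BFormula α))) :
    Tree (BFormula α) → BFormula α → Prop
  | assumption (Γ A) : Sequent.mk Γ A ∈ Φ → Derivable Φ Γ A
  | id (A) : Derivable Φ (.leaf A) A
  | distr (A B C) : Derivable Φ (.leaf (.and A (.or B C))) (.or (.and A B) (.and A C))
  | bot (Γ : Context (BFormula α)) (A) : Derivable Φ (Γ.plug (.leaf .bot)) A
  | top (Γ) : Derivable Φ Γ .top
  | neg1 (A) : Derivable Φ (.leaf (.and A (.neg A))) .bot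
  | neg2 (A) : Derivable Φ (.leaf .top) (.or A (.neg A))
  | underL (Γ : Context (BFormula α)) (Δ A B C) :
      Derivable Φ Δ A → Derivable Φ (Γ.plug (.leaf B)) C →
      Derivable Φ (Γ.plug (.node Δ (.leaf (.under A B)))) C
  | underR (Γ A B) : Derivable Φ (.node (.leaf A) Γ) B → Derivable Φ Γ (.under A B)
  | overL (Γ : Context (BFormula α)) (Δ A B C) :
      Derivable Φ (Γ.plug (.leaf A)) C → Derivable Φ Δ B →
      Derivable Φ (Γ.plug (.node (.leaf (.over A B)) Δ)) C
  | overR (Γ A B) : Derivable Φ (.node Γ (.leaf B)) A → Derivable Φ Γ (.over A B)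
  | prodL (Γ : Context (BFormula α)) (A B C) :
      Derivable Φ (Γ.plug (.node (.leaf A) (.leaf B))) C →
      Derivable Φ (Γ.plug (.leaf (.prod A B))) C
  | prodR (Γ Δ A B) :
      Derivable Φ Γ A → Derivable Φ Δ B → Derivable Φ (.node Γ Δ) (.prod A B)
  | cut (Γ : Context (BFormula α)) (Δ A B) :
      Derivable Φ Δ A → Derivable Φ (Γ.plug (.leaf A)) B → Derivable Φ (Γ.plug Δ) B
  | andL1 (Γ : Context (BFormula α)) (A₁ A₂ B) :
      Derivable Φ (Γ.plug (.leaf A₁)) B → Derivable Φ (Γ.plug (.leaf (.and A₁ A₂))) B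
  | andL2 (Γ : Context (BFormula α)) (A₁ A₂ B) :
      Derivable Φ (Γ.plug (.leaf A₂)) B → Derivable Φ (Γ.plug (.leaf (.and A₁ A₂))) B
  | andR (Γ A B) : Derivable Φ Γ A → Derivable Φ Γ B → Derivable Φ Γ (.and A B)
  | orL (Γ : Context (BFormula α)) (A₁ A₂ B) :
      Derivable Φ (Γ.plug (.leaf A₁)) B → Derivable Φ (Γ.plug (.leaf A₂)) B →
      Derivable Φ (Γ.plug (.leaf (.or A₁ A₂))) B
  | orR1 (Γ A₁ A₂) : Derivable Φ Γ A₁ → Derivable Φ Γ (.or A₁ A₂)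
  | orR2 (Γ A₁ A₂) : Derivable Φ Γ A₂ → Derivable Φ Γ (.or A₁ A₂)
  | unitLIntro (Γ : Context (BFormula α)) (Δ A) :
      Derivable Φ (Γ.plug Δ) A → Derivable Φ (Γ.plug (.node .empty Δ)) A
  | unitLElim (Γ : Context (BFormula α)) (Δ A) :
      Derivable Φ (Γ.plug (.node .empty Δ)) A → Derivable Φ (Γ.plug Δ) A
  | unitRIntro (Γ : Context (BFormula α)) (Δ A) :
      Derivable Φ (Γ.plug Δ) A → Derivable Φ (Γ.plug (.node Δ .empty)) A
  | unitRElim (Γ : Context (BFormula α)) (Δ A) :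
      Derivable Φ (Γ.plug (.node Δ .empty)) A → Derivable Φ (Γ.plug Δ) A

/-- `BDFNL.Derivable Φ Γ A`: the sequent `Γ ⇒ A` is derivable from the assumptions `Φ` in the
sequent calculus BDFNL*, which is BFNL* without Boolean negation and its two axioms. The assumptions are
not closed under substitution. The last four rules express that the empty antecedent `Λ` is neutral,
`Λ ∘ Δ = Δ = Δ ∘ Λ`; in all rules the metavariables for antecedents may be empty. -/
inductive BDFNL.Derivable {α : Type u} (Φ : Set (Sequent (BDFormula α))) :
    Tree (BDFormula α) → BDFormula α → Prop
  | assumption (Γ A) : Sequent.mk Γ A ∈ Φ → Derivable Φ Γ A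
  | id (A) : Derivable Φ (.leaf A) A
  | distr (A B C) : Derivable Φ (.leaf (.and A (.or B C))) (.or (.and A B) (.and A C))
  | bot (Γ : Context (BDFormula α)) (A) : Derivable Φ (Γ.plug (.leaf .bot)) A
  | top (Γ) : Derivable Φ Γ .top
  | underL (Γ : Context (BDFormula α)) (Δ A B C) :
      Derivable Φ Δ A → Derivable Φ (Γ.plug (.leaf B)) C →
      Derivable Φ (Γ.plug (.node Δ (.leaf (.under A B)))) C
  | underR (Γ A B) : Derivable Φ (.node (.leaf A) Γ) B → Derivable Φ Γ (.under A B)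
  | overL (Γ : Context (BDFormula α)) (Δ A B C) :
      Derivable Φ (Γ.plug (.leaf A)) C → Derivable Φ Δ B →
      Derivable Φ (Γ.plug (.node (.leaf (.over A B)) Δ)) C
  | overR (Γ A B) : Derivable Φ (.node Γ (.leaf B)) A → Derivable Φ Γ (.over A B)
  | prodL (Γ : Context (BDFormula α)) (A B C) :
      Derivable Φ (Γ.plug (.node (.leaf A) (.leaf B))) C →
      Derivable Φ (Γ.plug (.leaf (.prod A B))) C
  | prodR (Γ Δ A B) :
      Derivable Φ Γ A → Derivable Φ Δ B → Derivable Φ (.node Γ Δ) (.prod A B)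
  | cut (Γ : Context (BDFormula α)) (Δ A B) :
      Derivable Φ Δ A → Derivable Φ (Γ.plug (.leaf A)) B → Derivable Φ (Γ.plug Δ) B
  | andL1 (Γ : Context (BDFormula α)) (A₁ A₂ B) :
      Derivable Φ (Γ.plug (.leaf A₁)) B → Derivable Φ (Γ.plug (.leaf (.and A₁ A₂))) B
  | andL2 (Γ : Context (BDFormula α)) (A₁ A₂ B) :
      Derivable Φ (Γ.plug (.leaf A₂)) B → Derivable Φ (Γ.plug (.leaf (.and A₁ A₂))) B
  | andR (Γ A B) : Derivable Φ Γ A → Derivable Φ Γ B → Derivable Φ Γ (.and A B)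
  | orL (Γ : Context (BDFormula α)) (A₁ A₂ B) :
      Derivable Φ (Γ.plug (.leaf A₁)) B → Derivable Φ (Γ.plug (.leaf A₂)) B →
      Derivable Φ (Γ.plug (.leaf (.or A₁ A₂))) B
  | orR1 (Γ A₁ A₂) : Derivable Φ Γ A₁ → Derivable Φ Γ (.or A₁ A₂)
  | orR2 (Γ A₁ A₂) : Derivable Φ Γ A₂ → Derivable Φ Γ (.or A₁ A₂)
  | unitLIntro (Γ : Context (BDFormula α)) (Δ A) :
      Derivable Φ (Γ.plug Δ) A → Derivable Φ (Γ.plug (.node .empty Δ)) A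
  | unitLElim (Γ : Context (BDFormula α)) (Δ A) :
      Derivable Φ (Γ.plug (.node .empty Δ)) A → Derivable Φ (Γ.plug Δ) A
  | unitRIntro (Γ : Context (BDFormula α)) (Δ A) :
      Derivable Φ (Γ.plug Δ) A → Derivable Φ (Γ.plug (.node Δ .empty)) A
  | unitRElim (Γ : Context (BDFormula α)) (Δ A) :
      Derivable Φ (Γ.plug (.node Δ .empty)) A → Derivable Φ (Γ.plug Δ) A

/-- The propositional letters `P` enriched with a fresh letter `p_A = compl A` for every negation-free
formula `A` over the enriched set of letters. -/
inductive Letter (P : Type u) : Type u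
  | base (p : P)
  | compl (A : BDFormula (Letter P))

/-- The formula consisting of the letter `p_A`. -/
def complLetter {P : Type u} (A : BDFormula (Letter P)) : BDFormula (Letter P) :=
  .letter (.compl A)

/-- The map `~`: it exchanges `⊤` and `⊥` and sends any other `A` to the letter `p_A`. -/
def tilde {P : Type u} : BDFormula (Letter P) → BDFormula (Letter P)
  | .top => .bot
  | .bot => .top
  | A => complLetter A

/-- The embedding `‡`, which eliminates Boolean negation: `(¬A)‡ = (A‡)~`. -/
def ddagger {P : Type u} : BFormula P → BDFormula (Letter P)
  | .letter p => .letter (.base p)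
  | .bot => .bot
  | .top => .top
  | .and A B => .and (ddagger A) (ddagger B)
  | .or A B => .or (ddagger A) (ddagger B)
  | .under A B => .under (ddagger A) (ddagger B)
  | .over A B => .over (ddagger A) (ddagger B)
  | .prod A B => .prod (ddagger A) (ddagger B)
  | .neg A => tilde (ddagger A)

/-- The set of subformulas of a formula, including the formula itself. -/
def BFormula.subformulas {P : Type u} : BFormula P → Set (BFormula P)
  | .letter p => {.letter p}
  | .bot => {.bot}
  | .top => {.top}
  | .and A B => {.and A B} ∪ (A.subformulas ∪ B.subformulas)
  | .or A B => {.or A B} ∪ (A.subformulas ∪ B.subformulas)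
  | .under A B => {.under A B} ∪ (A.subformulas ∪ B.subformulas)
  | .over A B => {.over A B} ∪ (A.subformulas ∪ B.subformulas)
  | .prod A B => {.prod A B} ∪ (A.subformulas ∪ B.subformulas)
  | .neg A => {.neg A} ∪ A.subformulas

/-- The set `T` of all subformulas of the formulas occurring in `Γ ⇒ A`, together with `⊤` and `⊥`. -/
def sequentFormulas {P : Type u} (Γ : Tree (BFormula P)) (A : BFormula P) : Set (BFormula P) :=
  {B | ∃ C ∈ Γ.formulas ∪ {A}, B ∈ C.subformulas} ∪ {.top, .bot}

/-- `exn(T)`: the formulas of `T`, rendered in the language of BDFNL* by `‡`. -/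
def exn {P : Type u} (T : Set (BFormula P)) : Set (BDFormula (Letter P)) :=
  ddagger '' T

/-- `Ψ[S]`: the sequents `A ∧ p_A ⇒ ⊥` and `⊤ ⇒ A ∨ p_A`, for `A ∈ S`. -/
def Psi {P : Type u} (S : Set (BDFormula (Letter P))) : Set (Sequent (BDFormula (Letter P))) :=
  {s | ∃ A ∈ S, s = ⟨.leaf (.and A (complLetter A)), .bot⟩} ∪
    {s | ∃ A ∈ S, s = ⟨.leaf .top, .or A (complLetter A)⟩}

end Lambek

namespace Lambek

-- From right to left the argument is syntactic. Substituting `¬A` for each letter `p_A` turns a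
-- BDFNL*-derivation from `Ψ` into a BFNL*-derivation, since the assumptions become the two negation
-- axioms (`BFNL.derivable_unfold`). The substitution undoes `‡` up to interderivability
-- (`unfold_ddagger`). This direction holds for `Ψ[S]` with any `S`.
--
-- From left to right the argument is semantic. BFNL* is sound for ternary relational frames with
-- classical negation (`Frame.sound`), so it suffices to refute, in such a frame, a sequent whose
-- `‡`-image is not derivable from `Ψ[exn(T)]`. The points come from prime filters of
-- BDFNL*-formulas. For `A` in `exn(T)` the assumptions force a prime filter to contain exactly one
-- of `A` and `p_A`, so that `p_A` behaves as Boolean negation there (`complLetter_mem_iff`), and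
-- comparable prime filters agree on `exn(T)` (`Agree.of_subset`).
--
-- The difficulty is the empty antecedent: a unit must satisfy `e ∘ y = y`, while prime filters only
-- yield an inclusion `y ⊆ z`. The canonical frame therefore adds a copy of each prime filter
-- containing all theorems, lets the copies form the unit, and makes them act strictly as
-- identities. By agreement on `exn(T)` this change is invisible to subformulas of the sequent
-- (`rel_agree`), and the truth lemma `sat_iff` survives.

-- Contexts under maps and composition

/-- Applies a map of formulas at every leaf of a context. -/
def Context.map {F G : Type u} (f : F → G) : Context F → Context G
  | .hole => .hole
  | .nodeL Γ Δ => .nodeL (Γ.map f) (Δ.map f)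
  | .nodeR Δ Γ => .nodeR (Δ.map f) (Γ.map f)

theorem Context.map_plug {F G : Type u} (f : F → G) (C : Context F) (Γ : Tree F) :
    (C.plug Γ).map f = (C.map f).plug (Γ.map f) := by
  induction C with
  | hole => rfl
  | nodeL C Δ ih => simp [Context.plug, Context.map, Tree.map, ih]
  | nodeR Δ C ih => simp [Context.plug, Context.map, Tree.map, ih]

/-- Composition of contexts. -/
def Context.comp {F : Type u} : Context F → Context F → Context F
  | .hole, D => D
  | .nodeL C Δ, D => .nodeL (C.comp D) Δ
  | .nodeR Δ C, D => .nodeR Δ (C.comp D)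

theorem Context.comp_plug {F : Type u} (C D : Context F) (Γ : Tree F) :
    (C.comp D).plug Γ = C.plug (D.plug Γ) := by
  induction C with
  | hole => rfl
  | nodeL C Δ ih => simp [Context.plug, Context.comp, ih]
  | nodeR Δ C ih => simp [Context.plug, Context.comp, ih]

/-! ### Finiteness of the set of assumptions -/

theorem BFormula.finite_subformulas {P : Type u} (A : BFormula P) : A.subformulas.Finite := by
  induction A with
  | letter | bot | top => exact Set.finite_singleton _
  | neg _ h => exact (Set.finite_singleton _).union h
  | _ =>
    rename_i h₁ h₂
    exact (Set.finite_singleton _).union (h₁.union h₂)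

theorem Tree.finite_formulas {F : Type u} (Γ : Tree F) : Γ.formulas.Finite := by
  induction Γ with
  | empty => exact Set.finite_empty
  | leaf A => exact Set.finite_singleton A
  | node _ _ h₁ h₂ => exact h₁.union h₂

theorem finite_sequentFormulas {P : Type u} (Γ : Tree (BFormula P)) (A : BFormula P) :
    (sequentFormulas Γ A).Finite := by
  refine Set.Finite.union ?_ (Set.toFinite _)
  have := (Γ.finite_formulas.union (Set.finite_singleton A)).biUnion
    (t := fun C => C.subformulas) fun C _ => C.finite_subformulas
  refine this.subset ?_
  rintro B ⟨C, hC, hB⟩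
  exact Set.mem_biUnion hC hB

theorem finite_Psi {P : Type u} {S : Set (BDFormula (Letter P))} (hS : S.Finite) :
    (Psi S).Finite := by
  refine Set.Finite.union ?_ ?_
  · refine (hS.image fun A => Sequent.mk (.leaf (.and A (complLetter A))) .bot).subset ?_
    rintro s ⟨A, hA, rfl⟩
    exact ⟨A, hA, rfl⟩
  · refine (hS.image fun A => Sequent.mk (.leaf .top) (.or A (complLetter A))).subset ?_
    rintro s ⟨A, hA, rfl⟩
    exact ⟨A, hA, rfl⟩

theorem BFormula.mem_subformulas_self {P : Type u} (A : BFormula P) : A ∈ A.subformulas := by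
  cases A <;> simp [BFormula.subformulas]

/-! ### From BDFNL* to BFNL* -/

namespace BFNL

variable {α : Type u} {Φ : Set (Sequent (BFormula α))} {A B C A' B' : BFormula α}

/-- The sequent `A ⇒ B` is derivable. -/
abbrev Le (Φ : Set (Sequent (BFormula α))) (A B : BFormula α) : Prop :=
  Derivable Φ (.leaf A) B

theorem Derivable.trans {Γ : Tree (BFormula α)} (h₁ : Derivable Φ Γ A) (h₂ : Le Φ A B) :
    Derivable Φ Γ B :=
  .cut .hole Γ A B h₁ h₂

theorem and_left : Le Φ (.and A B) A := .andL1 .hole _ _ _ (.id _)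

theorem and_right : Le Φ (.and A B) B := .andL2 .hole _ _ _ (.id _)

theorem or_le (h₁ : Le Φ A C) (h₂ : Le Φ B C) : Le Φ (.or A B) C := .orL .hole _ _ _ h₁ h₂

theorem and_mono (h₁ : Le Φ A A') (h₂ : Le Φ B B') : Le Φ (.and A B) (.and A' B') :=
  .andR _ _ _ (and_left.trans h₁) (and_right.trans h₂)

theorem or_mono (h₁ : Le Φ A A') (h₂ : Le Φ B B') : Le Φ (.or A B) (.or A' B') :=
  or_le (.orR1 _ _ _ h₁) (.orR2 _ _ _ h₂)

theorem prod_mono (h₁ : Le Φ A A') (h₂ : Le Φ B B') : Le Φ (.prod A B) (.prod A' B') :=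
  .prodL .hole _ _ _ (.prodR _ _ _ _ h₁ h₂)

theorem under_mono (h₁ : Le Φ A' A) (h₂ : Le Φ B B') : Le Φ (.under A B) (.under A' B') :=
  .underR _ _ _ (.underL .hole _ _ _ _ h₁ h₂)

theorem over_mono (h₁ : Le Φ A A') (h₂ : Le Φ B' B) : Le Φ (.over A B) (.over A' B') :=
  .overR _ _ _ (.overL .hole _ _ _ _ h₁ h₂)

theorem bot_le : Le Φ .bot A := .bot .hole A

theorem le_top : Le Φ A .top := .top _

theorem le_or_neg : Le Φ B (.or A (.neg A)) := le_top.trans (.neg2 A)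

/-- By excluded middle and distributivity, `B` entails `(B ∧ A) ∨ (B ∧ ¬A)`, and the first disjunct
collapses to `⊥`. -/
theorem le_neg (h : Le Φ (.and B A) .bot) : Le Φ B (.neg A) :=
  ((Derivable.andR _ _ _ (.id B) (le_or_neg (A := A))).trans (.distr _ _ _)).trans
    (or_le (h.trans bot_le) and_right)

theorem neg_anti (h : Le Φ A B) : Le Φ (.neg B) (.neg A) :=
  le_neg ((Derivable.andR _ _ _ (and_right.trans h) and_left).trans (.neg1 B))

end BFNL

-- Undoing `‡` by substitution

mutual

/-- The value of a letter under the substitution of `¬A` for `p_A`. -/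
def unfoldLetter {P : Type u} : Letter P → BFormula P
  | .base p => .letter p
  | .compl A => .neg (unfold A)

/-- The substitution of `¬A` for every letter `p_A`. -/
def unfold {P : Type u} : BDFormula (Letter P) → BFormula P
  | .letter p => unfoldLetter p
  | .bot => .bot
  | .top => .top
  | .and A B => .and (unfold A) (unfold B)
  | .or A B => .or (unfold A) (unfold B)
  | .under A B => .under (unfold A) (unfold B)
  | .over A B => .over (unfold A) (unfold B)
  | .prod A B => .prod (unfold A) (unfold B)

end

theorem unfold_complLetter {P : Type u} (A : BDFormula (Letter P)) :
    unfold (complLetter A) = .neg (unfold A) := by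
  simp [complLetter, unfold, unfoldLetter]

/-- Only `⊤` and `⊥` need an argument, because `~` sends them to constants and not to letters. They
are also why `unfold` inverts `‡` only up to interderivability. -/
theorem unfold_tilde {P : Type u} (A : BDFormula (Letter P)) :
    BFNL.Le ∅ (unfold (tilde A)) (.neg (unfold A)) ∧
      BFNL.Le ∅ (.neg (unfold A)) (unfold (tilde A)) := by
  cases A with
  | top =>
    refine ⟨BFNL.bot_le, ?_⟩
    exact (BFNL.Derivable.andR _ _ _ BFNL.le_top (.id _)).trans (.neg1 _)
  | bot => exact ⟨BFNL.le_neg BFNL.and_right, BFNL.le_top⟩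
  | _ =>
    simp only [tilde, unfold_complLetter]
    exact ⟨.id _, .id _⟩

theorem unfold_ddagger {P : Type u} (A : BFormula P) :
    BFNL.Le ∅ (unfold (ddagger A)) A ∧ BFNL.Le ∅ A (unfold (ddagger A)) := by
  induction A with
  | letter p =>
    simp only [ddagger, unfold, unfoldLetter]
    exact ⟨.id _, .id _⟩
  | bot | top => exact ⟨.id _, .id _⟩
  | and A B h₁ h₂ => exact ⟨BFNL.and_mono h₁.1 h₂.1, BFNL.and_mono h₁.2 h₂.2⟩
  | or A B h₁ h₂ => exact ⟨BFNL.or_mono h₁.1 h₂.1, BFNL.or_mono h₁.2 h₂.2⟩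
  | under A B h₁ h₂ => exact ⟨BFNL.under_mono h₁.2 h₂.1, BFNL.under_mono h₁.1 h₂.2⟩
  | prod A B h₁ h₂ => exact ⟨BFNL.prod_mono h₁.1 h₂.1, BFNL.prod_mono h₁.2 h₂.2⟩
  | neg A h =>
    exact ⟨(unfold_tilde _).1.trans (BFNL.neg_anti h.2),
      BFNL.Derivable.trans (BFNL.neg_anti h.1) (unfold_tilde _).2⟩
  | _ =>
    rename_i h₁ h₂
    exact ⟨BFNL.over_mono h₁.1 h₂.2, BFNL.over_mono h₁.2 h₂.1⟩

theorem BFNL.derivable_unfold {P : Type u} {S : Set (BDFormula (Letter P))}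
    {Γ : Tree (BDFormula (Letter P))} {A : BDFormula (Letter P)}
    (h : BDFNL.Derivable (Psi S) Γ A) : BFNL.Derivable ∅ (Γ.map unfold) (unfold A) := by
  induction h with
  | assumption Γ A h =>
    rcases h with ⟨B, -, h⟩ | ⟨B, -, h⟩
    · cases h
      simp only [Tree.map, unfold, unfold_complLetter]
      exact .neg1 _
    · cases h
      simp only [Tree.map, unfold, unfold_complLetter]
      exact .neg2 _
  | id A => exact .id _
  | distr A B C => exact .distr _ _ _
  | bot Γ A => rw [Context.map_plug]; exact .bot _ _
  | top Γ => exact .top _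
  | underL Γ Δ A B C _ _ h₁ h₂ =>
    rw [Context.map_plug] at h₂ ⊢; exact .underL _ _ _ _ _ h₁ h₂
  | underR Γ A B _ h => exact .underR _ _ _ h
  | overL Γ Δ A B C _ _ h₁ h₂ =>
    rw [Context.map_plug] at h₁ ⊢; exact .overL _ _ _ _ _ h₁ h₂
  | overR Γ A B _ h => exact .overR _ _ _ h
  | prodL Γ A B C _ h => rw [Context.map_plug] at h ⊢; exact .prodL _ _ _ _ h
  | prodR Γ Δ A B _ _ h₁ h₂ => exact .prodR _ _ _ _ h₁ h₂
  | cut Γ Δ A B _ _ h₁ h₂ => rw [Context.map_plug] at h₂ ⊢; exact .cut _ _ _ _ h₁ h₂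
  | andL1 Γ A₁ A₂ B _ h => rw [Context.map_plug] at h ⊢; exact .andL1 _ _ _ _ h
  | andL2 Γ A₁ A₂ B _ h => rw [Context.map_plug] at h ⊢; exact .andL2 _ _ _ _ h
  | andR Γ A B _ _ h₁ h₂ => exact .andR _ _ _ h₁ h₂
  | orL Γ A₁ A₂ B _ _ h₁ h₂ =>
    rw [Context.map_plug] at h₁ h₂ ⊢; exact .orL _ _ _ _ h₁ h₂
  | orR1 Γ A₁ A₂ _ h => exact .orR1 _ _ _ h
  | orR2 Γ A₁ A₂ _ h => exact .orR2 _ _ _ h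
  | unitLIntro Γ Δ A _ h => rw [Context.map_plug] at h ⊢; exact .unitLIntro _ _ _ h
  | unitLElim Γ Δ A _ h => rw [Context.map_plug] at h ⊢; exact .unitLElim _ _ _ h
  | unitRIntro Γ Δ A _ h => rw [Context.map_plug] at h ⊢; exact .unitRIntro _ _ _ h
  | unitRElim Γ Δ A _ h => rw [Context.map_plug] at h ⊢; exact .unitRElim _ _ _ h

theorem Tree.map_map {F G H : Type u} (f : F → G) (g : G → H) (Γ : Tree F) :
    (Γ.map f).map g = Γ.map (g ∘ f) := by
  induction Γ with
  | empty | leaf => rfl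
  | node _ _ h₁ h₂ => simp [Tree.map, h₁, h₂]

/-- Replacing every leaf of a tree by a larger formula reflects derivability. -/
theorem BFNL.derivable_of_map {α : Type u} {Φ : Set (Sequent (BFormula α))}
    {f : BFormula α → BFormula α} (hf : ∀ A, Le Φ A (f A)) {B : BFormula α}
    (Γ : Tree (BFormula α)) (C : Context (BFormula α)) (h : Derivable Φ (C.plug (Γ.map f)) B) :
    Derivable Φ (C.plug Γ) B := by
  induction Γ generalizing C with
  | empty => exact h
  | leaf A => exact .cut C _ (f A) B (hf A) h
  | node Γ Δ ih₁ ih₂ =>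
    have h₁ := ih₁ (C.comp (.nodeL .hole (Δ.map f))) (by rw [Context.comp_plug]; exact h)
    rw [Context.comp_plug] at h₁
    have h₂ := ih₂ (C.comp (.nodeR Γ .hole)) (by rw [Context.comp_plug]; exact h₁)
    rw [Context.comp_plug] at h₂
    exact h₂

theorem BFNL.derivable_of_ddagger {P : Type u} {S : Set (BDFormula (Letter P))}
    {Γ : Tree (BFormula P)} {A : BFormula P}
    (h : BDFNL.Derivable (Psi S) (Γ.map ddagger) (ddagger A)) : BFNL.Derivable ∅ Γ A := by
  have h₁ := (derivable_unfold h).trans (unfold_ddagger A).1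
  rw [Tree.map_map] at h₁
  exact derivable_of_map (fun B => (unfold_ddagger B).2) Γ .hole h₁

/-! ### Relational semantics of BFNL* -/

/-- Ternary relational frames with a set of points acting as a unit. -/
structure Frame (W : Type u) where
  rel : W → W → W → Prop
  unit : Set W
  eq_of_unit_left : ∀ e ∈ unit, ∀ y z, rel e y z → y = z
  exists_unit_left : ∀ y, ∃ e ∈ unit, rel e y y
  eq_of_unit_right : ∀ e ∈ unit, ∀ y z, rel y e z → y = z
  exists_unit_right : ∀ y, ∃ e ∈ unit, rel y e y

namespace Frame

variable {W P : Type u} (M : Frame W) (V : P → Set W)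

/-- Truth of a formula at a point. -/
def Sat : BFormula P → W → Prop
  | .letter p, w => w ∈ V p
  | .bot, _ => False
  | .top, _ => True
  | .and A B, w => Sat A w ∧ Sat B w
  | .or A B, w => Sat A w ∨ Sat B w
  | .under A B, w => ∀ y z, M.rel y w z → Sat A y → Sat B z
  | .over A B, w => ∀ y z, M.rel w y z → Sat B y → Sat A z
  | .prod A B, w => ∃ x y, M.rel x y w ∧ Sat A x ∧ Sat B y
  | .neg A, w => ¬ Sat A w

/-- Truth of an antecedent at a point. -/
def TreeSat : Tree (BFormula P) → W → Prop
  | .empty, w => w ∈ M.unit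
  | .leaf A, w => M.Sat V A w
  | .node Γ Δ, w => ∃ x y, M.rel x y w ∧ TreeSat Γ x ∧ TreeSat Δ y

theorem TreeSat.plug_mono {Γ Δ : Tree (BFormula P)}
    (h : ∀ w, M.TreeSat V Γ w → M.TreeSat V Δ w) (C : Context (BFormula P)) (w : W)
    (hw : M.TreeSat V (C.plug Γ) w) : M.TreeSat V (C.plug Δ) w := by
  induction C generalizing w with
  | hole => exact h w hw
  | nodeL C Θ ih =>
    obtain ⟨x, y, hr, hx, hy⟩ := hw
    exact ⟨x, y, hr, ih x hx, hy⟩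
  | nodeR Θ C ih =>
    obtain ⟨x, y, hr, hx, hy⟩ := hw
    exact ⟨x, y, hr, hx, ih y hy⟩

theorem TreeSat.plug_bot (C : Context (BFormula P)) (w : W) :
    ¬ M.TreeSat V (C.plug (.leaf .bot)) w := by
  induction C generalizing w with
  | hole => exact id
  | nodeL C Θ ih => rintro ⟨x, y, hr, hx, hy⟩; exact ih x hx
  | nodeR Θ C ih => rintro ⟨x, y, hr, hx, hy⟩; exact ih y hy

/-- The composition of antecedents is existential, hence distributes over unions in each argument.
This is what (∨L) requires inside a context. -/
theorem TreeSat.plug_or {A B : BFormula P} (C : Context (BFormula P)) (w : W)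
    (h : M.TreeSat V (C.plug (.leaf (.or A B))) w) :
    M.TreeSat V (C.plug (.leaf A)) w ∨ M.TreeSat V (C.plug (.leaf B)) w := by
  induction C generalizing w with
  | hole => exact h
  | nodeL C Θ ih =>
    obtain ⟨x, y, hr, hx, hy⟩ := h
    exact (ih x hx).imp (fun h => ⟨x, y, hr, h, hy⟩) fun h => ⟨x, y, hr, h, hy⟩
  | nodeR Θ C ih =>
    obtain ⟨x, y, hr, hx, hy⟩ := h
    exact (ih y hy).imp (fun h => ⟨x, y, hr, hx, h⟩) fun h => ⟨x, y, hr, hx, h⟩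

theorem treeSat_node_empty (Γ : Tree (BFormula P)) (w : W) :
    M.TreeSat V (.node .empty Γ) w ↔ M.TreeSat V Γ w := by
  constructor
  · rintro ⟨e, y, hr, he, hy⟩
    exact M.eq_of_unit_left e he y w hr ▸ hy
  · intro h
    obtain ⟨e, he, hr⟩ := M.exists_unit_left w
    exact ⟨e, w, hr, he, h⟩

theorem treeSat_empty_node (Γ : Tree (BFormula P)) (w : W) :
    M.TreeSat V (.node Γ .empty) w ↔ M.TreeSat V Γ w := by
  constructor
  · rintro ⟨y, e, hr, hy, he⟩
    exact M.eq_of_unit_right e he y w hr ▸ hy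
  · intro h
    obtain ⟨e, he, hr⟩ := M.exists_unit_right w
    exact ⟨w, e, hr, h, he⟩

theorem sound {Γ : Tree (BFormula P)} {A : BFormula P} (h : BFNL.Derivable ∅ Γ A) :
    ∀ w, M.TreeSat V Γ w → M.Sat V A w := by
  induction h with
  | assumption _ _ h => exact h.elim
  | id A => exact fun _ h => h
  | distr A B C =>
    rintro w ⟨hA, hB | hC⟩
    · exact .inl ⟨hA, hB⟩
    · exact .inr ⟨hA, hC⟩
  | bot Γ A => exact fun w h => (TreeSat.plug_bot M V Γ w h).elim
  | top Γ => exact fun _ _ => trivial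
  | neg1 A => exact fun w h => h.2 h.1
  | neg2 A => exact fun w _ => em _
  | underL Γ Δ A B C _ _ h₁ h₂ =>
    refine fun w hw => h₂ w (TreeSat.plug_mono M V ?_ Γ w hw)
    rintro z ⟨y, x, hr, hy, hx⟩
    exact hx y z hr (h₁ y hy)
  | underR Γ A B _ h => exact fun w hw y z hr hy => h z ⟨y, w, hr, hy, hw⟩
  | overL Γ Δ A B C _ _ h₁ h₂ =>
    refine fun w hw => h₁ w (TreeSat.plug_mono M V ?_ Γ w hw)
    rintro z ⟨y, x, hr, hy, hx⟩
    exact hy x z hr (h₂ x hx)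
  | overR Γ A B _ h => exact fun w hw y z hr hy => h z ⟨w, y, hr, hw, hy⟩
  | prodL Γ A B C _ h => exact fun w hw => h w (TreeSat.plug_mono (Γ := .leaf (.prod A B))
      (Δ := .node (.leaf A) (.leaf B)) M V (fun _ h => h) Γ w hw)
  | prodR Γ Δ A B _ _ h₁ h₂ =>
    rintro w ⟨x, y, hr, hx, hy⟩
    exact ⟨x, y, hr, h₁ x hx, h₂ y hy⟩
  | cut Γ Δ A B _ _ h₁ h₂ => exact fun w hw => h₂ w (TreeSat.plug_mono M V h₁ Γ w hw)
  | andL1 Γ A₁ A₂ B _ h =>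
    exact fun w hw => h w (TreeSat.plug_mono (Γ := .leaf (.and A₁ A₂))
      (Δ := .leaf A₁) M V (fun _ h => h.1) Γ w hw)
  | andL2 Γ A₁ A₂ B _ h =>
    exact fun w hw => h w (TreeSat.plug_mono (Γ := .leaf (.and A₁ A₂))
      (Δ := .leaf A₂) M V (fun _ h => h.2) Γ w hw)
  | andR Γ A B _ _ h₁ h₂ => exact fun w hw => ⟨h₁ w hw, h₂ w hw⟩
  | orL Γ A₁ A₂ B _ _ h₁ h₂ =>
    exact fun w hw => (TreeSat.plug_or M V Γ w hw).elim (h₁ w) (h₂ w)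
  | orR1 Γ A₁ A₂ _ h => exact fun w hw => .inl (h w hw)
  | orR2 Γ A₁ A₂ _ h => exact fun w hw => .inr (h w hw)
  | unitLIntro Γ Δ A _ h =>
    exact fun w hw => h w (TreeSat.plug_mono M V (fun w => (M.treeSat_node_empty V Δ w).1) Γ w hw)
  | unitLElim Γ Δ A _ h =>
    exact fun w hw => h w (TreeSat.plug_mono M V (fun w => (M.treeSat_node_empty V Δ w).2) Γ w hw)
  | unitRIntro Γ Δ A _ h =>
    exact fun w hw => h w (TreeSat.plug_mono M V (fun w => (M.treeSat_empty_node V Δ w).1) Γ w hw)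
  | unitRElim Γ Δ A _ h =>
    exact fun w hw => h w (TreeSat.plug_mono M V (fun w => (M.treeSat_empty_node V Δ w).2) Γ w hw)

end Frame

/-! ### Prime filters of BDFNL*-formulas -/

namespace BDFNL

variable {α : Type u} {Φ : Set (Sequent (BDFormula α))} {A B C A' B' : BDFormula α}

/-- The sequent `A ⇒ B` is derivable. -/
abbrev Le (Φ : Set (Sequent (BDFormula α))) (A B : BDFormula α) : Prop :=
  Derivable Φ (.leaf A) B

theorem Derivable.trans {Γ : Tree (BDFormula α)} (h₁ : Derivable Φ Γ A) (h₂ : Le Φ A B) :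
    Derivable Φ Γ B :=
  .cut .hole Γ A B h₁ h₂

theorem and_left : Le Φ (.and A B) A := .andL1 .hole _ _ _ (.id _)

theorem and_right : Le Φ (.and A B) B := .andL2 .hole _ _ _ (.id _)

theorem or_le (h₁ : Le Φ A C) (h₂ : Le Φ B C) : Le Φ (.or A B) C := .orL .hole _ _ _ h₁ h₂

theorem and_mono (h₁ : Le Φ A A') (h₂ : Le Φ B B') : Le Φ (.and A B) (.and A' B') :=
  .andR _ _ _ (and_left.trans h₁) (and_right.trans h₂)

theorem or_mono (h₁ : Le Φ A A') (h₂ : Le Φ B B') : Le Φ (.or A B) (.or A' B') :=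
  or_le (.orR1 _ _ _ h₁) (.orR2 _ _ _ h₂)

theorem prod_mono (h₁ : Le Φ A A') (h₂ : Le Φ B B') : Le Φ (.prod A B) (.prod A' B') :=
  .prodL .hole _ _ _ (.prodR _ _ _ _ h₁ h₂)

theorem bot_le : Le Φ .bot A := .bot .hole A

theorem le_top : Le Φ A .top := .top _

theorem le_under (h : Le Φ (.prod A C) B) : Le Φ C (.under A B) :=
  .underR _ _ _ ((Derivable.prodR _ _ _ _ (.id A) (.id C)).trans h)

theorem prod_under_le : Le Φ (.prod A (.under A B)) B :=
  .prodL .hole _ _ _ (.underL .hole _ _ _ _ (.id A) (.id B))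

theorem le_over (h : Le Φ (.prod C A) B) : Le Φ C (.over B A) :=
  .overR _ _ _ ((Derivable.prodR _ _ _ _ (.id C) (.id A)).trans h)

theorem over_prod_le : Le Φ (.prod (.over B A) A) B :=
  .prodL .hole _ _ _ (.overL .hole _ _ _ _ (.id B) (.id A))

/-- A binary operation on formulas that is monotone in both arguments and preserves finite joins
in the first. -/
structure IsOperator (Φ : Set (Sequent (BDFormula α)))
    (m : BDFormula α → BDFormula α → BDFormula α) : Prop where
  mono : ∀ {A A' B B'}, Le Φ A A' → Le Φ B B' → Le Φ (m A B) (m A' B')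
  bot : ∀ B, Le Φ (m .bot B) .bot
  or : ∀ A A' B, Le Φ (m (.or A A') B) (.or (m A B) (m A' B))

theorem isOperator_prod : IsOperator Φ .prod where
  mono := prod_mono
  bot _ := .prodL .hole _ _ _ (.bot (.nodeL .hole _) _)
  or _ _ _ := .prodL .hole _ _ _ (.orL (.nodeL .hole _) _ _ _
    (.orR1 _ _ _ (.prodR _ _ _ _ (.id _) (.id _)))
    (.orR2 _ _ _ (.prodR _ _ _ _ (.id _) (.id _))))

/-- The product preserves joins on both sides; the swapped form lets one extension lemma serve both
arguments. -/
theorem isOperator_prod_swap : IsOperator Φ fun A B => .prod B A where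
  mono h₁ h₂ := prod_mono h₂ h₁
  bot _ := .prodL .hole _ _ _ (.bot (.nodeR _ .hole) _)
  or _ _ _ := .prodL .hole _ _ _ (.orL (.nodeR _ .hole) _ _ _
    (.orR1 _ _ _ (.prodR _ _ _ _ (.id _) (.id _)))
    (.orR2 _ _ _ (.prodR _ _ _ _ (.id _) (.id _))))

/-- Sets of formulas closed under finite meets and derivable consequence. -/
structure IsFilter (Φ : Set (Sequent (BDFormula α))) (f : Set (BDFormula α)) : Prop where
  top_mem : .top ∈ f
  and_mem : ∀ {A B}, A ∈ f → B ∈ f → .and A B ∈ f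
  mem_of_le : ∀ {A B}, A ∈ f → Le Φ A B → B ∈ f

/-- Proper filters that contain a member of every join they contain. -/
structure IsPrimeFilter (Φ : Set (Sequent (BDFormula α))) (f : Set (BDFormula α)) : Prop
    extends IsFilter Φ f where
  bot_notMem : .bot ∉ f
  mem_or_mem : ∀ {A B}, .or A B ∈ f → A ∈ f ∨ B ∈ f

/-- Sets of formulas closed under finite joins and downwards under derivability. -/
structure IsIdeal (Φ : Set (Sequent (BDFormula α))) (i : Set (BDFormula α)) : Prop where
  bot_mem : .bot ∈ i
  or_mem : ∀ {A B}, A ∈ i → B ∈ i → .or A B ∈ i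
  mem_of_le : ∀ {A B}, B ∈ i → Le Φ A B → A ∈ i

theorem isFilter_derivable (Γ : Tree (BDFormula α)) : IsFilter Φ {A | Derivable Φ Γ A} where
  top_mem := .top _
  and_mem h₁ h₂ := .andR _ _ _ h₁ h₂
  mem_of_le h₁ h₂ := h₁.trans h₂

theorem isIdeal_le (B : BDFormula α) : IsIdeal Φ {A | Le Φ A B} where
  bot_mem := bot_le
  or_mem := or_le
  mem_of_le h₁ h₂ := Derivable.trans h₂ h₁

-- Separation by prime filters

/-- The filter generated by a filter and a formula. -/
theorem IsFilter.adjoin {f : Set (BDFormula α)} (hf : IsFilter Φ f) (A : BDFormula α) :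
    IsFilter Φ {C | ∃ G ∈ f, Le Φ (.and G A) C} where
  top_mem := ⟨.top, hf.top_mem, le_top⟩
  and_mem := by
    rintro C D ⟨G, hG, hC⟩ ⟨H, hH, hD⟩
    exact ⟨.and G H, hf.and_mem hG hH, .andR _ _ _
      (Derivable.trans (and_mono and_left (.id _)) hC)
      (Derivable.trans (and_mono and_right (.id _)) hD)⟩
  mem_of_le := by
    rintro C D ⟨G, hG, hC⟩ h
    exact ⟨G, hG, hC.trans h⟩

/-- The prime filter theorem for distributive lattices: by Zorn's lemma take a filter above `f`
maximal among those disjoint from `i`; distributivity makes it prime. -/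
theorem exists_isPrimeFilter {f i : Set (BDFormula α)} (hf : IsFilter Φ f) (hi : IsIdeal Φ i)
    (hd : ∀ A ∈ f, A ∉ i) : ∃ x, IsPrimeFilter Φ x ∧ f ⊆ x ∧ ∀ A ∈ x, A ∉ i := by
  obtain ⟨x, hfx, ⟨hx, hxi⟩, hmax⟩ :=
    zorn_subset_nonempty {g | IsFilter Φ g ∧ ∀ A ∈ g, A ∉ i} (by
      intro c hc hchain hne
      refine ⟨⋃₀ c, ⟨⟨?_, ?_, ?_⟩, ?_⟩, fun s hs => Set.subset_sUnion_of_mem hs⟩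
      · obtain ⟨g, hg⟩ := hne
        exact ⟨g, hg, (hc hg).1.top_mem⟩
      · rintro A B ⟨g, hg, hA⟩ ⟨h, hh, hB⟩
        rcases hchain.total hg hh with hgh | hgh
        · exact ⟨h, hh, (hc hh).1.and_mem (hgh hA) hB⟩
        · exact ⟨g, hg, (hc hg).1.and_mem hA (hgh hB)⟩
      · rintro A B ⟨g, hg, hA⟩ h
        exact ⟨g, hg, (hc hg).1.mem_of_le hA h⟩
      · rintro A ⟨g, hg, hA⟩
        exact (hc hg).2 A hA) f ⟨hf, hd⟩
  -- By maximality, the filter generated by `x` and an outside formula `A` must meet `i`.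
  have key : ∀ A, A ∉ x → ∃ G ∈ x, .and G A ∈ i := by
    intro A hA
    by_contra! hcon
    refine hA (hmax ⟨hx.adjoin A, ?_⟩ ?_ ⟨.top, hx.top_mem, and_right⟩)
    · rintro C ⟨G, hG, hC⟩ hCi
      exact hcon G hG (hi.mem_of_le hCi hC)
    · exact fun G hG => ⟨G, hG, and_left⟩
  refine ⟨x, ⟨hx, fun h => hxi _ h hi.bot_mem, ?_⟩, hfx, hxi⟩
  intro A B hAB
  by_contra! hcon
  obtain ⟨G, hG, hGA⟩ := key A hcon.1
  obtain ⟨H, hH, hHB⟩ := key B hcon.2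
  -- The formula `(G ∧ H) ∧ (A ∨ B)` is in `x`, yet it lies below `(G ∧ A) ∨ (H ∧ B)`, which is in
  -- `i`.
  refine hxi _ (hx.and_mem (hx.and_mem hG hH) hAB) (hi.mem_of_le (hi.or_mem hGA hHB) ?_)
  exact Derivable.trans (.distr _ _ _)
    (or_mono (and_mono and_left (.id _)) (and_mono and_right (.id _)))

/-- The formulas `A` with `m A B ∉ z` for some `B ∈ g` form an ideal, because `m` preserves joins
and `z` is prime. The hypothesis says that `f` avoids this ideal, so a prime filter separates them.
-/
theorem exists_isPrimeFilter_operator {m : BDFormula α → BDFormula α → BDFormula α}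
    (hm : IsOperator Φ m) {f g z : Set (BDFormula α)} (hf : IsFilter Φ f) (hg : IsFilter Φ g)
    (hz : IsPrimeFilter Φ z) (h : ∀ A ∈ f, ∀ B ∈ g, m A B ∈ z) :
    ∃ x, IsPrimeFilter Φ x ∧ f ⊆ x ∧ ∀ A ∈ x, ∀ B ∈ g, m A B ∈ z := by
  have hi : IsIdeal Φ {A | ∃ B ∈ g, m A B ∉ z} := by
    refine ⟨⟨.top, hg.top_mem, fun h => hz.bot_notMem (hz.mem_of_le h (hm.bot _))⟩, ?_, ?_⟩
    · rintro A A' ⟨B, hB, hA⟩ ⟨B', hB', hA'⟩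
      -- Monotonicity in the second argument makes the meet a common witness for both disjuncts.
      refine ⟨.and B B', hg.and_mem hB hB', fun h => ?_⟩
      rcases hz.mem_or_mem (hz.mem_of_le h (hm.or _ _ _)) with h | h
      · exact hA (hz.mem_of_le h (hm.mono (.id _) and_left))
      · exact hA' (hz.mem_of_le h (hm.mono (.id _) and_right))
    · rintro A A' ⟨B, hB, hA⟩ h
      exact ⟨B, hB, fun h' => hA (hz.mem_of_le h' (hm.mono h (.id _)))⟩
  obtain ⟨x, hx, hfx, hxi⟩ := exists_isPrimeFilter hf hi (by
    rintro A hA ⟨B, hB, hAB⟩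
    exact hAB (h A hA B hB))
  refine ⟨x, hx, hfx, fun A hA B hB => ?_⟩
  by_contra hcon
  exact hxi A hA ⟨B, hB, hcon⟩

-- The canonical product relation on filters

/-- All products of members of `x` and members of `y` belong to `z`. -/
def ProdSubset (x y z : Set (BDFormula α)) : Prop :=
  ∀ A ∈ x, ∀ B ∈ y, .prod A B ∈ z

variable {f g z : Set (BDFormula α)}

theorem exists_prodSubset_left (hf : IsFilter Φ f) (hg : IsFilter Φ g)
    (hz : IsPrimeFilter Φ z) (h : ProdSubset f g z) :
    ∃ x, IsPrimeFilter Φ x ∧ f ⊆ x ∧ ProdSubset x g z :=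
  exists_isPrimeFilter_operator isOperator_prod hf hg hz h

theorem exists_prodSubset_right (hf : IsFilter Φ f) (hg : IsFilter Φ g)
    (hz : IsPrimeFilter Φ z) (h : ProdSubset f g z) :
    ∃ y, IsPrimeFilter Φ y ∧ g ⊆ y ∧ ProdSubset f y z := by
  obtain ⟨y, hy, hgy, h'⟩ := exists_isPrimeFilter_operator isOperator_prod_swap hg hf hz
    fun _ hA _ hB => h _ hB _ hA
  exact ⟨y, hy, hgy, fun A hA B hB => h' B hB A hA⟩

theorem exists_prodSubset (hf : IsFilter Φ f) (hg : IsFilter Φ g)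
    (hz : IsPrimeFilter Φ z) (h : ProdSubset f g z) :
    ∃ x y, IsPrimeFilter Φ x ∧ IsPrimeFilter Φ y ∧ f ⊆ x ∧ g ⊆ y ∧ ProdSubset x y z := by
  obtain ⟨x, hx, hfx, h₁⟩ := exists_prodSubset_left hf hg hz h
  obtain ⟨y, hy, hgy, h₂⟩ := exists_prodSubset_right hx.toIsFilter hg hz h₁
  exact ⟨x, y, hx, hy, hfx, hgy, h₂⟩

theorem exists_of_prod_mem (hz : IsPrimeFilter Φ z) (h : .prod A B ∈ z) :
    ∃ x y, IsPrimeFilter Φ x ∧ IsPrimeFilter Φ y ∧ A ∈ x ∧ B ∈ y ∧ ProdSubset x y z := by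
  obtain ⟨x, y, hx, hy, hA, hB, hp⟩ := exists_prodSubset (isFilter_derivable (.leaf A))
    (isFilter_derivable (.leaf B)) hz fun C hC D hD => hz.mem_of_le h (prod_mono hC hD)
  exact ⟨x, y, hx, hy, hA (Derivable.id A), hB (Derivable.id B), hp⟩

/-- By residuation, `B` is outside the filter generated by the products `A · C` with `C ∈ f`.
Separate that filter from `B` by a prime `z`, then enlarge the principal filter of `A` to a prime
`y`, keeping `f` and `z` fixed. -/
theorem exists_of_under_notMem (hf : IsFilter Φ f) (h : .under A B ∉ f) :
    ∃ y z, IsPrimeFilter Φ y ∧ IsPrimeFilter Φ z ∧ A ∈ y ∧ B ∉ z ∧ ProdSubset y f z := by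
  have hF : IsFilter Φ {G | ∃ C ∈ f, Le Φ (.prod A C) G} := by
    refine ⟨⟨.top, hf.top_mem, le_top⟩, ?_, ?_⟩
    · rintro G H ⟨C, hC, hG⟩ ⟨D, hD, hH⟩
      exact ⟨.and C D, hf.and_mem hC hD, .andR _ _ _
        (Derivable.trans (prod_mono (.id _) and_left) hG)
        (Derivable.trans (prod_mono (.id _) and_right) hH)⟩
    · rintro G H ⟨C, hC, hG⟩ hGH
      exact ⟨C, hC, hG.trans hGH⟩
  obtain ⟨z, hz, hFz, hB⟩ := exists_isPrimeFilter hF (isIdeal_le B) (by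
    rintro G ⟨C, hC, hG⟩ hGB
    exact h (hf.mem_of_le hC (le_under (hG.trans hGB))))
  obtain ⟨y, hy, hAy, hp⟩ := exists_prodSubset_left (isFilter_derivable (.leaf A)) hf hz
    fun D hD C hC => hFz ⟨C, hC, prod_mono hD (.id _)⟩
  exact ⟨y, z, hy, hz, hAy (Derivable.id A), fun h => hB B h (.id B), hp⟩

theorem exists_of_over_notMem (hf : IsFilter Φ f) (h : .over B A ∉ f) :
    ∃ y z, IsPrimeFilter Φ y ∧ IsPrimeFilter Φ z ∧ A ∈ y ∧ B ∉ z ∧ ProdSubset f y z := by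
  have hF : IsFilter Φ {G | ∃ C ∈ f, Le Φ (.prod C A) G} := by
    refine ⟨⟨.top, hf.top_mem, le_top⟩, ?_, ?_⟩
    · rintro G H ⟨C, hC, hG⟩ ⟨D, hD, hH⟩
      exact ⟨.and C D, hf.and_mem hC hD, .andR _ _ _
        (Derivable.trans (prod_mono and_left (.id _)) hG)
        (Derivable.trans (prod_mono and_right (.id _)) hH)⟩
    · rintro G H ⟨C, hC, hG⟩ hGH
      exact ⟨C, hC, hG.trans hGH⟩
  obtain ⟨z, hz, hFz, hB⟩ := exists_isPrimeFilter hF (isIdeal_le B) (by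
    rintro G ⟨C, hC, hG⟩ hGB
    exact h (hf.mem_of_le hC (le_over (hG.trans hGB))))
  obtain ⟨y, hy, hAy, hp⟩ := exists_prodSubset_right hf (isFilter_derivable (.leaf A)) hz
    fun C hC D hD => hFz ⟨C, hC, prod_mono (.id _) hD⟩
  exact ⟨y, z, hy, hz, hAy (Derivable.id A), fun h => hB B h (.id B), hp⟩

-- The theorems as a unit up to inclusion

/-- The formulas derivable from the empty antecedent. -/
def theorems (Φ : Set (Sequent (BDFormula α))) : Set (BDFormula α) :=
  {A | Derivable Φ .empty A}

theorem isFilter_theorems : IsFilter Φ (theorems Φ) := isFilter_derivable .empty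

theorem prodSubset_theorems_left (hz : IsPrimeFilter Φ z) : ProdSubset (theorems Φ) z z :=
  fun _ hA B hB => hz.mem_of_le hB
    (.unitLElim .hole _ _ (.prodR _ _ _ _ hA (.id B)))

theorem prodSubset_theorems_right (hz : IsPrimeFilter Φ z) : ProdSubset z (theorems Φ) z :=
  fun B hB _ hA => hz.mem_of_le hB
    (.unitRElim .hole _ _ (.prodR _ _ _ _ (.id B) hA))

/-- Since `A / A` is a theorem, `(A / A) · A` lies in `z` for each `A ∈ x`, and it entails `A`. -/
theorem subset_of_prodSubset_left {e x : Set (BDFormula α)} (he : theorems Φ ⊆ e)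
    (hz : IsPrimeFilter Φ z) (h : ProdSubset e x z) : x ⊆ z := fun A hA =>
  hz.mem_of_le (h (.over A A) (he (.overR _ _ _ (.unitLIntro .hole _ _ (.id A)))) A hA)
    over_prod_le

theorem subset_of_prodSubset_right {e x : Set (BDFormula α)} (he : theorems Φ ⊆ e)
    (hz : IsPrimeFilter Φ z) (h : ProdSubset x e z) : x ⊆ z := fun A hA =>
  hz.mem_of_le (h A hA (.under A A) (he (.underR _ _ _ (.unitRIntro .hole _ _ (.id A)))))
    prod_under_le

end BDFNL

/-! ### The canonical frame -/

namespace Canonical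

open BDFNL

variable {P : Type u} (S : Set (BDFormula (Letter P)))

/-- Prime filters with respect to derivability from `Ψ[S]`. -/
abbrev Point : Type u := {x : Set (BDFormula (Letter P)) // IsPrimeFilter (Psi S) x}

/-- Prime filters containing all formulas derivable from the empty antecedent. -/
abbrev UnitPoint : Type u := {x : Point S // theorems (Psi S) ⊆ x.1}

/-- The points of the canonical frame: the prime filters, and additional copies of those prime
filters that contain all theorems. The copies serve as the unit of the frame. -/
abbrev World : Type u := Point S ⊕ UnitPoint S

variable {S}

/-- The prime filter underlying a point of the canonical frame. -/
def World.point : World S → Point S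
  | .inl x => x
  | .inr e => e.1

/-- Prime filters containing the same formulas of `S`. -/
def Agree (x y : Point S) : Prop := ∀ A ∈ S, A ∈ x.1 ↔ A ∈ y.1

theorem Agree.refl (x : Point S) : Agree x x := fun _ _ => Iff.rfl

theorem Agree.symm {x y : Point S} (h : Agree x y) : Agree y x := fun A hA => (h A hA).symm

/-- Properness with `A ∧ p_A ⇒ ⊥` excludes having both; primeness with `⊤ ⇒ A ∨ p_A` excludes having
neither. -/
theorem complLetter_mem_iff (x : Point S) {A : BDFormula (Letter P)} (hA : A ∈ S) :
    complLetter A ∈ x.1 ↔ A ∉ x.1 := by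
  constructor
  · intro h h'
    exact x.2.bot_notMem (x.2.mem_of_le (x.2.and_mem h' h) (.assumption _ _ (.inl ⟨A, hA, rfl⟩)))
  · intro h
    exact (x.2.mem_or_mem (x.2.mem_of_le x.2.top_mem
      (.assumption _ _ (.inr ⟨A, hA, rfl⟩)))).resolve_left h

theorem tilde_mem_iff (x : Point S) {A : BDFormula (Letter P)} (hA : A ∈ S) :
    tilde A ∈ x.1 ↔ A ∉ x.1 := by
  cases A with
  | top => exact iff_of_false x.2.bot_notMem (not_not.2 x.2.top_mem)
  | bot => exact iff_of_true x.2.top_mem x.2.bot_notMem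
  | _ => exact complLetter_mem_iff x hA

/-- Inclusion of prime filters implies agreement, as the formulas of `S` have complements. -/
theorem Agree.of_subset {x y : Point S} (h : x.1 ⊆ y.1) : Agree x y := fun A hA =>
  ⟨fun h' => h h', fun h' => by
    by_contra hx
    exact (complLetter_mem_iff y hA).1 (h ((complLetter_mem_iff x hA).2 hx)) h'⟩

/-- The accessibility relation of the canonical frame. -/
def rel : World S → World S → World S → Prop
  | .inl x, .inl y, z => ProdSubset x.1 y.1 z.point.1
  -- A unit point must act as an identity, so the result is literally the other argument. The second
  -- conjunct keeps the product relation up to agreement on `S`, which is what the truth lemma uses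
  -- for the residuals.
  | .inl x, .inr e, z => z = .inl x ∧
      ∃ x' z' : Point S, Agree x' x ∧ Agree z' x ∧ ProdSubset x'.1 e.1.1 z'.1
  | .inr e, .inl y, z => z = .inl y ∧
      ∃ y' z' : Point S, Agree y' y ∧ Agree z' y ∧ ProdSubset e.1.1 y'.1 z'.1
  | .inr e, .inr e', z => e = e' ∧ z = .inr e

/-- Every accessible triple looks, on `S`, like a triple of prime filters in the product relation.
For two unit copies the left factor is a prime filter of theorems shrunk inside `e`, which agrees
with `e` by inclusion. -/
theorem rel_agree {x y z : World S} (h : rel x y z) : ∃ x' y' z' : Point S,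
    Agree x' x.point ∧ Agree y' y.point ∧ Agree z' z.point ∧ ProdSubset x'.1 y'.1 z'.1 := by
  rcases x with x | e <;> rcases y with y | e'
  · exact ⟨x, y, z.point, .refl _, .refl _, .refl _, h⟩
  · obtain ⟨rfl, x', z', hx, hz, h⟩ := h
    exact ⟨x', e'.1, z', hx, .refl _, hz, h⟩
  · obtain ⟨rfl, y', z', hy, hz, h⟩ := h
    exact ⟨e.1, y', z', .refl _, hy, hz, h⟩
  · obtain ⟨rfl, rfl⟩ := h
    obtain ⟨e', he', hsub, hp⟩ := exists_prodSubset_left isFilter_theorems e.1.2.toIsFilter e.1.2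
      (prodSubset_theorems_left e.1.2)
    exact ⟨⟨e', he'⟩, e.1, e.1, .of_subset (subset_of_prodSubset_right e.2 e.1.2 hp),
      .refl _, .refl _, hp⟩

variable (S) in
/-- The canonical frame. -/
def frame : Frame (World S) where
  rel := rel
  unit := Set.range Sum.inr
  eq_of_unit_left := by
    rintro _ ⟨e, rfl⟩ (y | y) z h
    · exact h.1.symm
    · obtain ⟨rfl, rfl⟩ := h
      rfl
  exists_unit_left := by
    rintro (y | y)
    · obtain ⟨e, he, hsub, hp⟩ := exists_prodSubset_left isFilter_theorems y.2.toIsFilter y.2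
        (prodSubset_theorems_left y.2)
      exact ⟨.inr ⟨⟨e, he⟩, hsub⟩, ⟨_, rfl⟩, rfl, y, y, .refl _, .refl _, hp⟩
    · exact ⟨.inr y, ⟨_, rfl⟩, rfl, rfl⟩
  eq_of_unit_right := by
    rintro _ ⟨e, rfl⟩ (y | y) z h
    · exact h.1.symm
    · exact h.2.symm
  exists_unit_right := by
    rintro (y | y)
    · obtain ⟨e, he, hsub, hp⟩ := exists_prodSubset_right y.2.toIsFilter isFilter_theorems y.2
        (prodSubset_theorems_right y.2)
      exact ⟨.inr ⟨⟨e, he⟩, hsub⟩, ⟨_, rfl⟩, rfl, y, y, .refl _, .refl _, hp⟩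
    · exact ⟨.inr y, ⟨_, rfl⟩, rfl, rfl⟩

variable (S) in
/-- The canonical valuation. -/
def val (p : P) : Set (World S) := {w | .letter (.base p) ∈ w.point.1}

theorem exists_rel_of_under_notMem {A B : BDFormula (Letter P)} (w : World S)
    (h : .under A B ∉ w.point.1) :
    ∃ y z, rel y w z ∧ A ∈ y.point.1 ∧ B ∉ z.point.1 := by
  obtain ⟨y, z, hy, hz, hA, hB, hp⟩ := exists_of_under_notMem w.point.2.toIsFilter h
  rcases w with x | e
  · exact ⟨.inl ⟨y, hy⟩, .inl ⟨z, hz⟩, hp, hA, hB⟩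
  -- At a unit copy the third point is forced to equal `y`. As `y ⊆ z`, it omits `B` too, and `z`
  -- serves as the agreeing witness.
  · have hyz := subset_of_prodSubset_right e.2 hz hp
    exact ⟨.inl ⟨y, hy⟩, .inl ⟨y, hy⟩, ⟨rfl, ⟨y, hy⟩, ⟨z, hz⟩, .refl _,
      (Agree.of_subset hyz).symm, hp⟩, hA, fun h => hB (hyz h)⟩

theorem exists_rel_of_over_notMem {A B : BDFormula (Letter P)} (w : World S)
    (h : .over B A ∉ w.point.1) :
    ∃ y z, rel w y z ∧ A ∈ y.point.1 ∧ B ∉ z.point.1 := by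
  obtain ⟨y, z, hy, hz, hA, hB, hp⟩ := exists_of_over_notMem w.point.2.toIsFilter h
  rcases w with x | e
  · exact ⟨.inl ⟨y, hy⟩, .inl ⟨z, hz⟩, hp, hA, hB⟩
  · have hyz := subset_of_prodSubset_left e.2 hz hp
    exact ⟨.inl ⟨y, hy⟩, .inl ⟨y, hy⟩, ⟨rfl, ⟨y, hy⟩, ⟨z, hz⟩, .refl _,
      (Agree.of_subset hyz).symm, hp⟩, hA, fun h => hB (hyz h)⟩

/-- The truth lemma. Subformulas must stay in `T` because `rel` is tied to the product relation only
up to agreement on `exn T`, and because `~` acts as negation only there. -/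
theorem sat_iff {T : Set (BFormula P)} (A : BFormula P) (hA : A.subformulas ⊆ T)
    (w : World (exn T)) :
    (frame (exn T)).Sat (val (exn T)) A w ↔ ddagger A ∈ w.point.1 := by
  have mem {A : BFormula P} (hA : A.subformulas ⊆ T) : ddagger A ∈ exn T :=
    ⟨A, hA A.mem_subformulas_self, rfl⟩
  induction A generalizing w with
  | letter p => exact Iff.rfl
  | bot => exact iff_of_false id w.point.2.bot_notMem
  | top => exact iff_of_true trivial w.point.2.top_mem
  | and A B ih₁ ih₂ =>
    have h := Set.union_subset_iff.1 (Set.union_subset_iff.1 hA).2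
    have hw := w.point.2
    simp only [Frame.Sat, ih₁ h.1, ih₂ h.2, ddagger]
    exact ⟨fun h => hw.and_mem h.1 h.2,
      fun h => ⟨hw.mem_of_le h and_left, hw.mem_of_le h and_right⟩⟩
  | or A B ih₁ ih₂ =>
    have h := Set.union_subset_iff.1 (Set.union_subset_iff.1 hA).2
    have hw := w.point.2
    simp only [Frame.Sat, ih₁ h.1, ih₂ h.2, ddagger]
    exact ⟨fun h => h.elim (fun h => hw.mem_of_le h (.orR1 _ _ _ (.id _)))
      fun h => hw.mem_of_le h (.orR2 _ _ _ (.id _)), hw.mem_or_mem⟩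
  | under A B ih₁ ih₂ =>
    have h := Set.union_subset_iff.1 (Set.union_subset_iff.1 hA).2
    simp only [Frame.Sat, ih₁ h.1, ih₂ h.2, ddagger]
    constructor
    · intro hw
      by_contra hcon
      obtain ⟨y, z, hr, hy, hz⟩ := exists_rel_of_under_notMem w hcon
      exact hz (hw y z hr hy)
    · intro hw y z hr hy
      -- Move the two premises to the agreeing triple, apply residuation there, and move the
      -- conclusion back.
      obtain ⟨y', w', z', hy', hw', hz', hp⟩ := rel_agree hr
      exact (hz' _ (mem h.2)).1 (z'.2.mem_of_le
        (hp _ ((hy' _ (mem h.1)).2 hy) _ ((hw' _ (mem hA)).2 hw)) prod_under_le)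
  | prod A B ih₁ ih₂ =>
    have h := Set.union_subset_iff.1 (Set.union_subset_iff.1 hA).2
    simp only [Frame.Sat, ih₁ h.1, ih₂ h.2, ddagger]
    constructor
    · rintro ⟨x, y, hr, hx, hy⟩
      obtain ⟨x', y', w', hx', hy', hw', hp⟩ := rel_agree hr
      exact (hw' _ (mem hA)).1 (hp _ ((hx' _ (mem h.1)).2 hx) _ ((hy' _ (mem h.2)).2 hy))
    · intro hw
      obtain ⟨x, y, hx, hy, hA, hB, hp⟩ := exists_of_prod_mem w.point.2 hw
      -- For two ordinary points `rel` sees only the filter underlying the third, so this also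
      -- covers a unit copy `w`.
      exact ⟨.inl ⟨x, hx⟩, .inl ⟨y, hy⟩, hp, hA, hB⟩
  | neg A ih =>
    have h := (Set.union_subset_iff.1 hA).2
    simp only [Frame.Sat, ih h, ddagger]
    exact (tilde_mem_iff _ (mem h)).symm
  | _ =>
    rename_i A B ih₁ ih₂
    have h := Set.union_subset_iff.1 (Set.union_subset_iff.1 hA).2
    simp only [Frame.Sat, ih₁ h.1, ih₂ h.2, ddagger]
    constructor
    · intro hw
      by_contra hcon
      obtain ⟨y, z, hr, hy, hz⟩ := exists_rel_of_over_notMem w hcon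
      exact hz (hw y z hr hy)
    · intro hw y z hr hy
      obtain ⟨w', y', z', hw', hy', hz', hp⟩ := rel_agree hr
      exact (hz' _ (mem h.1)).1 (z'.2.mem_of_le
        (hp _ ((hw' _ (mem hA)).2 hw) _ ((hy' _ (mem h.2)).2 hy)) over_prod_le)

end Canonical

/-! ### Completeness -/

/-- Removes the empty antecedents inside an antecedent. -/
def Tree.reduce {F : Type u} : Tree F → Tree F
  | .empty => .empty
  | .leaf A => .leaf A
  | .node Γ Δ =>
    match Γ.reduce, Δ.reduce with
    | .empty, Δ' => Δ'
    | Γ', .empty => Γ'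
    | Γ', Δ' => .node Γ' Δ'

/-- Antecedents in which the empty antecedent does not occur. -/
def Tree.NoEmpty {F : Type u} : Tree F → Prop
  | .empty => False
  | .leaf _ => True
  | .node Γ Δ => Γ.NoEmpty ∧ Δ.NoEmpty

theorem Tree.reduce_node_cases {F : Type u} (Γ Δ : Tree F) :
    (Γ.reduce = .empty ∧ (Tree.node Γ Δ).reduce = Δ.reduce) ∨
    (Δ.reduce = .empty ∧ (Tree.node Γ Δ).reduce = Γ.reduce) ∨
    (Γ.reduce ≠ .empty ∧ Δ.reduce ≠ .empty ∧
      (Tree.node Γ Δ).reduce = .node Γ.reduce Δ.reduce) := by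
  rw [Tree.reduce]
  cases Γ.reduce <;> cases Δ.reduce <;> simp

theorem Tree.reduce_eq_empty_or {F : Type u} (Γ : Tree F) :
    Γ.reduce = .empty ∨ Γ.reduce.NoEmpty := by
  induction Γ with
  | empty => exact .inl rfl
  | leaf A => exact .inr trivial
  | node Γ Δ ih₁ ih₂ =>
    rcases Tree.reduce_node_cases Γ Δ with ⟨-, h⟩ | ⟨-, h⟩ | ⟨h₁, h₂, h⟩ <;> rw [h]
    · exact ih₂
    · exact ih₁
    · exact .inr ⟨ih₁.resolve_left h₁, ih₂.resolve_left h₂⟩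

theorem Tree.formulas_reduce_subset {F : Type u} (Γ : Tree F) :
    Γ.reduce.formulas ⊆ Γ.formulas := by
  induction Γ with
  | empty | leaf => exact subset_rfl
  | node Γ Δ ih₁ ih₂ =>
    rcases Tree.reduce_node_cases Γ Δ with ⟨-, h⟩ | ⟨-, h⟩ | ⟨h₁, h₂, h⟩ <;> rw [h]
    · exact ih₂.trans Set.subset_union_right
    · exact ih₁.trans Set.subset_union_left
    · exact Set.union_subset_union ih₁ ih₂

theorem Frame.TreeSat.of_reduce {W P : Type u} (M : Frame W) (V : P → Set W)
    (Γ : Tree (BFormula P)) (w : W) (h : M.TreeSat V Γ.reduce w) : M.TreeSat V Γ w := by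
  induction Γ generalizing w with
  | empty | leaf => exact h
  | node Γ Δ ih₁ ih₂ =>
    rcases Tree.reduce_node_cases Γ Δ with ⟨h₁, h₂⟩ | ⟨h₁, h₂⟩ | ⟨-, -, h₂⟩ <;> rw [h₂] at h
    · obtain ⟨x, y, hr, hx, hy⟩ := (M.treeSat_node_empty V _ w).2 h
      exact ⟨x, y, hr, ih₁ x (h₁ ▸ hx), ih₂ y hy⟩
    · obtain ⟨x, y, hr, hx, hy⟩ := (M.treeSat_empty_node V _ w).2 h
      exact ⟨x, y, hr, ih₁ x hx, ih₂ y (h₁ ▸ hy)⟩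
    · obtain ⟨x, y, hr, hx, hy⟩ := h
      exact ⟨x, y, hr, ih₁ x hx, ih₂ y hy⟩

/-- Units are reinserted by the introduction rules for `Λ`; the surrounding context is arbitrary so
that the induction can enter each branch. -/
theorem BDFNL.derivable_of_reduce {α β : Type u} {Φ : Set (Sequent (BDFormula α))}
    {B : BDFormula α} (f : β → BDFormula α) (Γ : Tree β) (C : Context (BDFormula α))
    (h : Derivable Φ (C.plug (Γ.reduce.map f)) B) : Derivable Φ (C.plug (Γ.map f)) B := by
  induction Γ generalizing C with
  | empty | leaf => exact h
  | node Γ Δ ih₁ ih₂ =>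
    have h₁ : Derivable Φ (C.plug (.node (Γ.reduce.map f) (Δ.reduce.map f))) B := by
      rcases Tree.reduce_node_cases Γ Δ with ⟨h₁, h₂⟩ | ⟨h₁, h₂⟩ | ⟨-, -, h₂⟩ <;> rw [h₂] at h
      · rw [h₁]; exact .unitLIntro _ _ _ h
      · rw [h₁]; exact .unitRIntro _ _ _ h
      · exact h
    have h₂ := ih₁ (C.comp (.nodeL .hole (Δ.reduce.map f))) (by
      rw [Context.comp_plug]; exact h₁)
    rw [Context.comp_plug] at h₂
    have h₃ := ih₂ (C.comp (.nodeR (Γ.map f) .hole)) (by rw [Context.comp_plug]; exact h₂)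
    rw [Context.comp_plug] at h₃
    exact h₃

-- Products in `z` split into prime filters down to the leaves. All points so obtained are ordinary,
-- whereas `Λ` holds only at unit copies; hence the exclusion of empty antecedents.
open BDFNL in
theorem Canonical.treeSat_of_noEmpty {T : Set (BFormula P)} (Γ : Tree (BFormula P))
    (hne : Γ.NoEmpty) (hΓ : ∀ A ∈ Γ.formulas, A.subformulas ⊆ T) (z : Point (exn T))
    (hz : {A | Derivable (Psi (exn T)) (Γ.map ddagger) A} ⊆ z.1) :
    (frame (exn T)).TreeSat (val (exn T)) Γ (.inl z) := by
  induction Γ generalizing z with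
  | empty => exact hne.elim
  | leaf A => exact (sat_iff A (hΓ A rfl) _).2 (hz (Derivable.id _))
  | node Γ Δ ih₁ ih₂ =>
    obtain ⟨x, y, hx, hy, hΓx, hΔy, hp⟩ := exists_prodSubset
      (isFilter_derivable (Γ.map ddagger)) (isFilter_derivable (Δ.map ddagger)) z.2
      fun A hA B hB => hz (Derivable.prodR _ _ _ _ hA hB)
    exact ⟨.inl ⟨x, hx⟩, .inl ⟨y, hy⟩, hp,
      ih₁ hne.1 (fun A hA => hΓ A (.inl hA)) ⟨x, hx⟩ hΓx,
      ih₂ hne.2 (fun A hA => hΓ A (.inr hA)) ⟨y, hy⟩ hΔy⟩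

open BDFNL Canonical in
theorem BDFNL.derivable_ddagger {P : Type u} {T : Set (BFormula P)} {Γ : Tree (BFormula P)}
    {A : BFormula P} (hΓ : ∀ B ∈ Γ.formulas, B.subformulas ⊆ T) (hA : A.subformulas ⊆ T)
    (h : BFNL.Derivable ∅ Γ A) : Derivable (Psi (exn T)) (Γ.map ddagger) (ddagger A) := by
  by_contra hcon
  have hcon' : ¬ Derivable (Psi (exn T)) (Γ.reduce.map ddagger) (ddagger A) :=
    fun h => hcon (derivable_of_reduce ddagger Γ .hole h)
  obtain ⟨z, hz, hΓz, hAz⟩ := exists_isPrimeFilter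
    (isFilter_derivable (Γ.reduce.map ddagger)) (isIdeal_le (ddagger A))
    fun B hB hBA => hcon' (Derivable.trans hB hBA)
  -- Stated for any point over `z`, since the countermodel point is the unit copy of `z` when the
  -- antecedent reduces to `Λ` and the ordinary point otherwise.
  have refute (w : World (exn T)) (hw : w.point = ⟨z, hz⟩) :
      ¬ (frame (exn T)).TreeSat (val (exn T)) Γ.reduce w := by
    intro hsat
    have := (sat_iff A hA w).1 (Frame.sound _ _ h w (.of_reduce _ _ Γ w hsat))
    rw [hw] at this
    exact hAz _ this (.id _)
  rcases Γ.reduce_eq_empty_or with he | hne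
  -- Now `z` contains all theorems, so its copy exists and satisfies `Λ`.
  · rw [he] at hΓz
    exact refute (.inr ⟨⟨z, hz⟩, hΓz⟩) rfl (by rw [he]; exact ⟨_, rfl⟩)
  · exact refute (.inl ⟨z, hz⟩) rfl (treeSat_of_noEmpty _ hne
      (fun B hB => hΓ B (Γ.formulas_reduce_subset hB)) _ hΓz)

end Lambek

theorem mainTheorem3 {P : Type*} (Γ : Lambek.Tree (Lambek.BFormula P)) (A : Lambek.BFormula P) :
    (Lambek.Psi (Lambek.exn (Lambek.sequentFormulas Γ A))).Finite ∧
      (Lambek.BFNL.Derivable ∅ Γ A ↔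
        Lambek.BDFNL.Derivable (Lambek.Psi (Lambek.exn (Lambek.sequentFormulas Γ A)))
          (Γ.map Lambek.ddagger) (Lambek.ddagger A)) := by
  refine ⟨Lambek.finite_Psi ((Lambek.finite_sequentFormulas Γ A).image _), ?_,
    Lambek.BFNL.derivable_of_ddagger⟩
  exact Lambek.BDFNL.derivable_ddagger
    (fun B hB C hC => .inl ⟨B, .inl hB, hC⟩) (fun C hC => .inl ⟨A, .inr rfl, hC⟩)
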